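/- Let $M$ be a finite von Neumann algebra acting on a Hilbert space, with a faithful normal trace $\tau$ normalized by $\tau(1)=1$. Let $A\subseteq M$ be a masa (a maximal abelian self-adjoint subalgebra), and let $\mathbb{E}_A\colon M\to A$ be the unique $\tau$-preserving conditional expectation of $M$ onto $A$. For each nonzero projection $e\in M$ let $\Phi_e\colon eMe\to A$ be the map $\Phi_e(eye)=\mathbb{E}_A(eye)$, $y\in M$. Suppose that for every nonzero projection $e\in M$ the map $\Phi_e$ is not injective. Then for every $x\in A$ with $0\le x\le 1$ there exists a projection $p\in M$ such that $\mathbb{E}_A(p)=x$. Moreover, every extreme point of the convex set $\Gamma_x=\{y\in M : 0\le y\le 1,\ \mathbb{E}_A(y)=x\}$ is a projection. -/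

import Mathlib

open scoped InnerProductSpace

noncomputable section

namespace Carpenter

variable {H : Type*} [NormedAddCommGroup H] [InnerProductSpace ℂ H] [CompleteSpace H]

/-- The elements of a von Neumann algebra `M` acting on `H`, as a unital `*`-algebra with the
operator norm and the usual order of operators. -/
abbrev Elt (M : VonNeumannAlgebra H) : Type _ := M.toStarSubalgebra

variable {M : VonNeumannAlgebra H}

/-- Weak-`*` (that is, ultraweak) continuity of a linear functional on `M`: it has the form
`x ↦ ∑ₙ ⟨ηₙ, x ξₙ⟩` with `∑ₙ ‖ξₙ‖²` and `∑ₙ ‖ηₙ‖²` finite, so it belongs to the predual of `M`. -/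
def IsNormalFunctional (φ : Elt M →ₗ[ℂ] ℂ) : Prop :=
  ∃ ξ η : ℕ → H, Summable (fun n => ‖ξ n‖ ^ 2) ∧ Summable (fun n => ‖η n‖ ^ 2) ∧
    ∀ x : Elt M, HasSum (fun n => ⟪η n, (x : H →L[ℂ] H) (ξ n)⟫_ℂ) (φ x)

open scoped ComplexOrder in
/-- `τ` is a faithful normal normalized trace on `M`; a von Neumann algebra with such a trace
is finite. -/
structure IsFaithfulNormalTrace (τ : Elt M →ₗ[ℂ] ℂ) : Prop where
  map_one : τ 1 = 1
  nonneg : ∀ x, 0 ≤ x → 0 ≤ τ x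
  trace : ∀ x y, τ (x * y) = τ (y * x)
  faithful : ∀ x, 0 ≤ x → τ x = 0 → x = 0
  normal : IsNormalFunctional τ

/-- `A` is a masa in `M`: maximal among the abelian self-adjoint subalgebras of `M` (no closedness
is imposed: maximality forces `A = A' ∩ M`, so `A` is a von Neumann subalgebra). -/
def IsMasa (A : StarSubalgebra ℂ (Elt M)) : Prop :=
  Maximal (fun B : StarSubalgebra ℂ (Elt M) => ∀ x ∈ B, ∀ y ∈ B, x * y = y * x) A

/-- `E` is a `τ`-preserving conditional expectation of `M` onto `A`: a positive `A`-bimodule map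
that fixes every element of `A` and preserves `τ`. -/
structure IsTraceCondExp (τ : Elt M →ₗ[ℂ] ℂ) (A : StarSubalgebra ℂ (Elt M))
    (E : Elt M →ₗ[ℂ] A) : Prop where
  nonneg : ∀ x, 0 ≤ x → 0 ≤ E x
  map_coe : ∀ a : A, E a = a
  bimodule : ∀ (a b : A) (x : Elt M), E (a * x * b) = a * E x * b
  trace : ∀ x, τ (E x) = τ x

/-- The conditional expectation `𝔼_A` of `M` onto `A`: the `τ`-preserving one. For a faithful
normal trace `τ` and a masa `A` there is exactly one. -/
def condExp (τ : Elt M →ₗ[ℂ] ℂ) (A : StarSubalgebra ℂ (Elt M)) : Elt M →ₗ[ℂ] A :=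
  Classical.epsilon (IsTraceCondExp τ A)

/-- The corner `eMe = {e x e : x ∈ M}`. -/
def corner (e : Elt M) : Submodule ℂ (Elt M) :=
  LinearMap.range (LinearMap.mulLeft ℂ e ∘ₗ LinearMap.mulRight ℂ e)

/-- The map `Φ_e : eMe → A`, `e x e ↦ 𝔼_A(e x e)`. -/
def cornerMap (τ : Elt M →ₗ[ℂ] ℂ) (A : StarSubalgebra ℂ (Elt M)) (e : Elt M) :
    corner e →ₗ[ℂ] A :=
  condExp τ A ∘ₗ (corner e).subtype

/-- The convex set `Γ_x = {y ∈ M : 0 ≤ y ≤ 1, 𝔼_A(y) = x}`. -/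
def fiber (τ : Elt M →ₗ[ℂ] ℂ) (A : StarSubalgebra ℂ (Elt M)) (x : A) : Set (Elt M) :=
  {y | 0 ≤ y ∧ y ≤ 1 ∧ condExp τ A y = x}

end Carpenter

end

open scoped InnerProductSpace ComplexOrder
open Topology

noncomputable section

namespace Carpenter

variable {H : Type*} [NormedAddCommGroup H] [InnerProductSpace ℂ H] [CompleteSpace H]
variable {M : VonNeumannAlgebra H}

/-! The proof is Krein–Milman plus a perturbation. The fiber `Γ_x` contains `x`, and it is weakly
compact: effects form a weakly compact set (`isCompact_effects`), and `𝔼_A(y) = x` amounts to the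
conditions `τ(ay) = τ(ax)`, `a ∈ A`, which are weakly closed on effects because `τ` is normal
(`condExp_eq_iff`, `isCompact_traceFiber`). So `Γ_x` has an extreme point.

If `y ∈ Γ_x` is not a projection, then `ε e ≤ y` and `ε e ≤ 1 - y` for some nonzero projection `e ∈
M` and some `ε > 0` (`exists_projection_of_not_isStarProjection`). As `Φ_e` is not injective, its
kernel contains a self-adjoint `z ≠ 0`. For small `δ > 0` both `y ± δz` lie in `Γ_x`, so `y` is not
extreme.

`condExp` is a choice, so a conditional expectation must first be shown to exist.
`exists_mem_masa_of_effect` does this by minimizing `τ(y²)` over effects with prescribed values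
`τ(ay)`. -/

lemma opNonneg_iff (T : H →L[ℂ] H) : 0 ≤ T ↔ ∀ ξ, 0 ≤ ⟪ξ, T ξ⟫_ℂ := by
  rw [ContinuousLinearMap.nonneg_iff_isPositive]
  refine ⟨fun h ξ => h.inner_nonneg_right ξ, fun h => ?_⟩
  rw [ContinuousLinearMap.isPositive_iff_complex]
  intro ξ
  have h1 := h ξ
  rw [Complex.nonneg_iff] at h1
  rw [← inner_conj_symm (T ξ) ξ]
  refine ⟨?_, h1.1⟩
  apply Complex.ext
  · simp
  · rw [Complex.conj_im, ← h1.2]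
    simp

lemma elt_nonneg_iff (x : Elt M) : 0 ≤ x ↔ ∀ ξ, 0 ≤ ⟪ξ, (x : H →L[ℂ] H) ξ⟫_ℂ :=
  opNonneg_iff (x : H →L[ℂ] H)

lemma elt_le_one_iff (x : Elt M) :
    x ≤ 1 ↔ ∀ ξ, 0 ≤ ⟪ξ, ξ⟫_ℂ - ⟪ξ, (x : H →L[ℂ] H) ξ⟫_ℂ := by
  rw [← sub_nonneg, elt_nonneg_iff]
  simp

lemma mem_vonNeumannAlgebra_of_commute {T : H →L[ℂ] H}
    (h : ∀ S ∈ M.commutant, S * T = T * S) : T ∈ M := by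
  rw [← M.commutant_commutant, VonNeumannAlgebra.mem_commutant_iff]
  exact h

/-! ### Weak operator topology and compactness of the effects -/

/-- The elements of `M`, with the weak operator topology. -/
def WeakElt (M : VonNeumannAlgebra H) : Type _ := Elt M

instance : AddCommGroup (WeakElt M) := inferInstanceAs (AddCommGroup (Elt M))

instance : Module ℝ (WeakElt M) := inferInstanceAs (Module ℝ (Elt M))

/-- The matrix coefficients `⟪η, y ξ⟫` of `y`. -/
def weakForm (M : VonNeumannAlgebra H) : WeakElt M →ₗ[ℝ] (H → H → ℂ) where
  toFun y η ξ := ⟪η, (show Elt M from y : H →L[ℂ] H) ξ⟫_ℂ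
  map_add' x y := by
    funext η ξ
    exact inner_add_right _ _ _
  map_smul' r y := by
    funext η ξ
    exact inner_smul_right_eq_smul _ _ _

lemma weakForm_injective : Function.Injective (weakForm M) := by
  intro x y h
  apply Subtype.ext
  ext ξ
  exact ext_inner_left ℂ fun η => congrFun (congrFun h η) ξ

instance : TopologicalSpace (WeakElt M) := .induced (weakForm M) inferInstance

lemma isInducing_weakForm : IsInducing (weakForm M) := ⟨rfl⟩

instance : IsTopologicalAddGroup (WeakElt M) := topologicalAddGroup_induced (weakForm M)

instance : ContinuousSMul ℝ (WeakElt M) := continuousSMul_induced (weakForm M)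

instance : LocallyConvexSpace ℝ (WeakElt M) := LocallyConvexSpace.induced (weakForm M)

instance : T2Space (WeakElt M) :=
  T2Space.of_injective_continuous weakForm_injective isInducing_weakForm.continuous

lemma continuous_weakForm_apply (η ξ : H) : Continuous fun y : WeakElt M => weakForm M y η ξ :=
  (continuous_apply ξ).comp ((continuous_apply η).comp isInducing_weakForm.continuous)

/-- The elements `0 ≤ y ≤ 1` of `M`. -/
def effects (M : VonNeumannAlgebra H) : Set (WeakElt M) :=
  {y | 0 ≤ (show Elt M from y) ∧ (show Elt M from y) ≤ 1}

lemma norm_le_one_of_effect {x : Elt M} (h0 : 0 ≤ x) (h1 : x ≤ 1) : ‖(x : H →L[ℂ] H)‖ ≤ 1 :=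
  CStarAlgebra.norm_le_one_iff_of_nonneg (x : H →L[ℂ] H) (ha := h0) |>.2 h1

lemma norm_weakForm_le {y : WeakElt M} (hy : y ∈ effects M) (η ξ : H) :
    ‖weakForm M y η ξ‖ ≤ ‖η‖ * ‖ξ‖ := by
  refine (norm_inner_le_norm _ _).trans ?_
  gcongr
  refine (ContinuousLinearMap.le_opNorm _ _).trans ?_
  have := norm_le_one_of_effect hy.1 hy.2
  nlinarith [norm_nonneg ξ]

/-- A bounded sesquilinear form is given by an operator. -/
lemma exists_operator_of_form (B : H → H → ℂ)
    (hadd₁ : ∀ η η' ξ, B (η + η') ξ = B η ξ + B η' ξ)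
    (hsmul₁ : ∀ (c : ℂ) η ξ, B (c • η) ξ = starRingEnd ℂ c * B η ξ)
    (hadd₂ : ∀ η ξ ξ', B η (ξ + ξ') = B η ξ + B η ξ')
    (hsmul₂ : ∀ (c : ℂ) η ξ, B η (c • ξ) = c * B η ξ)
    (hbound : ∀ η ξ, ‖B η ξ‖ ≤ ‖η‖ * ‖ξ‖) :
    ∃ T : H →L[ℂ] H, ∀ η ξ, B η ξ = ⟪η, T ξ⟫_ℂ := by
  let L : H →ₗ⋆[ℂ] H →ₗ[ℂ] ℂ := LinearMap.mk₂'ₛₗ (starRingEnd ℂ) (RingHom.id ℂ) B hadd₁ hsmul₁ hadd₂ hsmul₂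
  let C : H →L⋆[ℂ] H →L[ℂ] ℂ := L.mkContinuous₂ 1 fun η ξ => by
    rw [one_mul]; exact hbound η ξ
  refine ⟨ContinuousLinearMap.adjoint (InnerProductSpace.continuousLinearMapOfBilin C),
    fun η ξ => ?_⟩
  rw [ContinuousLinearMap.adjoint_inner_right, InnerProductSpace.continuousLinearMapOfBilin_apply]
  rfl

/-- Each condition involves finitely many coefficients of `B`, so it is closed under pointwise
convergence. The last one encodes membership in `M` through the double commutant. -/
lemma image_effects : weakForm M '' effects M =
    {B | (∀ η η' ξ, B (η + η') ξ = B η ξ + B η' ξ) ∧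
      (∀ (c : ℂ) η ξ, B (c • η) ξ = starRingEnd ℂ c * B η ξ) ∧
      (∀ η ξ ξ', B η (ξ + ξ') = B η ξ + B η ξ') ∧
      (∀ (c : ℂ) η ξ, B η (c • ξ) = c * B η ξ) ∧
      (∀ η ξ, ‖B η ξ‖ ≤ ‖η‖ * ‖ξ‖) ∧ (∀ ξ, 0 ≤ B ξ ξ) ∧ (∀ ξ, 0 ≤ ⟪ξ, ξ⟫_ℂ - B ξ ξ) ∧
      ∀ S ∈ M.commutant, ∀ η ξ, B (star S η) ξ = B η (S ξ)} := by
  ext B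
  constructor
  · rintro ⟨y, hy, rfl⟩
    refine ⟨fun η η' ξ => inner_add_left _ _ _, fun c η ξ => inner_smul_left _ _ _,
      fun η ξ ξ' => ?_, fun c η ξ => ?_, norm_weakForm_le hy, (elt_nonneg_iff _).1 hy.1,
      (elt_le_one_iff _).1 hy.2, fun S hS η ξ => ?_⟩
    · simp [weakForm]
    · simp [weakForm]
    · have := VonNeumannAlgebra.mem_commutant_iff.1 hS _ (show Elt M from y).2
      have h2 := congrArg (fun T : H →L[ℂ] H => ⟪η, T ξ⟫_ℂ) this
      simp only [mul_apply_eq_comp] at h2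
      change ⟪star S η, (show Elt M from y : H →L[ℂ] H) ξ⟫_ℂ =
        ⟪η, (show Elt M from y : H →L[ℂ] H) (S ξ)⟫_ℂ
      rw [h2, ContinuousLinearMap.star_eq_adjoint, ContinuousLinearMap.adjoint_inner_left]
  · rintro ⟨h1, h2, h3, h4, h5, h6, h7, h8⟩
    obtain ⟨T, hT⟩ := exists_operator_of_form B h1 h2 h3 h4 h5
    have hTM : T ∈ M := by
      refine mem_vonNeumannAlgebra_of_commute fun S hS => ?_
      ext ξ
      refine ext_inner_left ℂ fun η => ?_
      have := h8 S hS η ξ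
      rw [hT, hT, ContinuousLinearMap.star_eq_adjoint,
        ContinuousLinearMap.adjoint_inner_left] at this
      exact this
    refine ⟨(⟨T, hTM⟩ : Elt M), ⟨(elt_nonneg_iff _).2 fun ξ => ?_,
      (elt_le_one_iff _).2 fun ξ => ?_⟩, ?_⟩
    · rw [← hT]; exact h6 ξ
    · rw [← hT]; exact h7 ξ
    · funext η ξ; exact (hT η ξ).symm

/-- Tychonoff: the matrix coefficients lie in a product of closed discs. -/
lemma isCompact_effects : IsCompact (effects M) := by
  rw [isInducing_weakForm.isCompact_iff]
  have hev : ∀ η ξ : H, Continuous fun B : H → H → ℂ => B η ξ := fun η ξ =>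
    (continuous_apply ξ).comp (continuous_apply η)
  have hcl : IsClosed (weakForm M '' effects M) := by
    rw [image_effects]
    simp only [Set.ofPred_and, Set.ofPred_forall]
    refine IsClosed.inter ?_ (IsClosed.inter ?_ (IsClosed.inter ?_ (IsClosed.inter ?_
      (IsClosed.inter ?_ (IsClosed.inter ?_ (IsClosed.inter ?_ ?_))))))
    all_goals repeat' refine isClosed_iInter fun _ => ?_
    · exact isClosed_eq (hev _ _) ((hev _ _).add (hev _ _))
    · exact isClosed_eq (hev _ _) (continuous_const.mul (hev _ _))
    · exact isClosed_eq (hev _ _) ((hev _ _).add (hev _ _))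
    · exact isClosed_eq (hev _ _) (continuous_const.mul (hev _ _))
    · exact isClosed_le (hev _ _).norm continuous_const
    · exact isClosed_le continuous_const (hev _ _)
    · exact isClosed_le continuous_const (continuous_const.sub (hev _ _))
    · exact isClosed_eq (hev _ _) (hev _ _)
  refine IsCompact.of_isClosed_subset (isCompact_univ_pi fun η : H => isCompact_univ_pi
    fun ξ : H => isCompact_closedBall (0 : ℂ) (‖η‖ * ‖ξ‖)) hcl ?_
  rintro _ ⟨y, hy, rfl⟩ η - ξ -
  rw [mem_closedBall_zero_iff]
  exact norm_weakForm_le hy η ξ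

/-- On effects the defining series converges uniformly, being dominated by `‖ηₙ‖² + ‖ξₙ‖²`. -/
lemma IsNormalFunctional.continuousOn {φ : Elt M →ₗ[ℂ] ℂ} (hφ : IsNormalFunctional φ) :
    ContinuousOn (fun y : WeakElt M => φ y) (effects M) := by
  obtain ⟨ξ, η, hξ, hη, h⟩ := hφ
  have h1 : (fun y : WeakElt M => φ y) = fun y => ∑' n, weakForm M y (η n) (ξ n) := by
    funext y
    exact (h y).tsum_eq.symm
  rw [h1]
  refine continuousOn_tsum (u := fun n => ‖η n‖ ^ 2 + ‖ξ n‖ ^ 2)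
    (fun n => (continuous_weakForm_apply _ _).continuousOn) (hη.add hξ) fun n y hy => ?_
  refine (norm_weakForm_le hy _ _).trans ?_
  nlinarith [sq_nonneg (‖η n‖ - ‖ξ n‖), sq_nonneg (‖η n‖), sq_nonneg (‖ξ n‖)]

lemma IsNormalFunctional.comp_mulLeft {φ : Elt M →ₗ[ℂ] ℂ} (hφ : IsNormalFunctional φ)
    (a : Elt M) : IsNormalFunctional (φ ∘ₗ LinearMap.mulLeft ℂ a) := by
  obtain ⟨ξ, η, hξ, hη, h⟩ := hφ
  refine ⟨ξ, fun n => (star a : Elt M).1 (η n), hξ, ?_, fun x => ?_⟩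
  · refine Summable.of_nonneg_of_le (fun n => sq_nonneg _) (fun n => ?_)
      (hη.mul_left (‖(star a : Elt M).1‖ ^ 2))
    rw [← mul_pow]
    gcongr
    exact ContinuousLinearMap.le_opNorm _ _
  · have key : (fun n => ⟪(star a : Elt M).1 (η n), (x : H →L[ℂ] H) (ξ n)⟫_ℂ) =
        fun n => ⟪η n, ((a * x : Elt M) : H →L[ℂ] H) (ξ n)⟫_ℂ := by
      funext n
      change ⟪star (a : H →L[ℂ] H) (η n), _⟫_ℂ =
        ⟪η n, (a : H →L[ℂ] H) ((x : H →L[ℂ] H) (ξ n))⟫_ℂ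
      rw [ContinuousLinearMap.star_eq_adjoint, ContinuousLinearMap.adjoint_inner_left]
    rw [key]
    exact h (a * x)

/-! ### Masas and their unitaries -/

lemma IsMasa.mem_of_commute {A : StarSubalgebra ℂ (Elt M)} (hA : IsMasa A) {y : Elt M}
    (hy : IsSelfAdjoint y) (h : ∀ a ∈ A, a * y = y * a) : y ∈ A := by
  have hle : A ≤ StarAlgebra.adjoin ℂ (insert y (A : Set (Elt M))) := fun a ha =>
    StarAlgebra.subset_adjoin ℂ _ (Set.mem_insert_of_mem _ ha)
  refine hA.le_of_ge ?_ hle (StarAlgebra.subset_adjoin ℂ _ (Set.mem_insert _ _))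
  have hcomm : ∀ a ∈ insert y (A : Set (Elt M)), ∀ b ∈ insert y (A : Set (Elt M)),
      a * b = b * a := by
    rintro a (rfl | ha) b (rfl | hb)
    · rfl
    · exact (h b hb).symm
    · exact h a ha
    · exact hA.prop a ha b hb
  have hstar : ∀ b ∈ insert y (A : Set (Elt M)), star b ∈ insert y (A : Set (Elt M)) := by
    rintro b (rfl | hb)
    · rw [hy.star_eq]
      exact Set.mem_insert _ _
    · exact Set.mem_insert_of_mem _ (star_mem (S := StarSubalgebra ℂ (Elt M)) hb)
  have := StarAlgebra.isMulCommutative_adjoin ℂ hcomm fun a ha b hb =>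
    hcomm a ha _ (hstar b hb)
  intro a ha b hb
  exact congrArg Subtype.val (this.is_comm.comm ⟨a, ha⟩ ⟨b, hb⟩)

/-- Every self-adjoint contraction `a` in a masa is the real part of a unitary `u` of the masa. -/
lemma IsMasa.exists_unitary {A : StarSubalgebra ℂ (Elt M)} (hA : IsMasa A) {a : Elt M}
    (ha : a ∈ A) (hsa : IsSelfAdjoint a) (hnorm : ‖(a : H →L[ℂ] H)‖ ≤ 1) :
    ∃ u ∈ A, star u * u = 1 ∧ u * star u = 1 ∧ u + star u = a + a := by
  have hT : IsSelfAdjoint (a : H →L[ℂ] H) := congrArg Subtype.val hsa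
  -- The unitary is `a + i√(1 - a²)`. The root commutes with everything that commutes with `a`,
  -- hence lies in `M` and then in `A`.
  set s : H →L[ℂ] H := CFC.sqrt (1 - (a : H →L[ℂ] H) ^ 2) with hs
  have hcomm : ∀ S : H →L[ℂ] H, Commute (a : H →L[ℂ] H) S → Commute s S := fun S hS =>
    Commute.cfcₙ_nnreal ((Commute.one_left S).sub_left (hS.pow_left 2)) _
  have hsM : s ∈ M := mem_vonNeumannAlgebra_of_commute fun S hS =>
    (hcomm S (VonNeumannAlgebra.mem_commutant_iff.1 hS _ a.2)).symm
  have hssa : IsSelfAdjoint s := (CFC.sqrt_nonneg _).isSelfAdjoint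
  let sM : Elt M := ⟨s, hsM⟩
  have hsA : sM ∈ A := hA.mem_of_commute (Subtype.ext hssa) fun b hb =>
    Subtype.ext (hcomm b (congrArg Subtype.val (hA.prop a ha b hb))).symm
  have hu := (selfAdjoint.unitarySelfAddISMul (⟨a, hT⟩ : selfAdjoint (H →L[ℂ] H)) hnorm).2
  rw [Unitary.mem_iff] at hu
  have hstar : star (a + Complex.I • sM) = a - Complex.I • sM := by
    apply Subtype.ext
    change star ((a : H →L[ℂ] H) + Complex.I • s) = (a : H →L[ℂ] H) - Complex.I • s
    rw [star_add, star_smul, hT.star_eq, hssa.star_eq]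
    simp [sub_eq_add_neg]
  refine ⟨a + Complex.I • sM, add_mem ha (SMulMemClass.smul_mem _ hsA), Subtype.ext hu.1,
    Subtype.ext hu.2, ?_⟩
  rw [hstar]
  abel

/-- The unitaries of `A` span it: scale a self-adjoint element to a contraction, then write it as
`(u + u*)/2`. -/
lemma IsMasa.commute_of_commute_unitary {A : StarSubalgebra ℂ (Elt M)} (hA : IsMasa A)
    {y : Elt M} (h : ∀ u ∈ A, star u * u = 1 → u * star u = 1 → u * y = y * u) :
    ∀ a ∈ A, a * y = y * a := by
  have hball : ∀ a ∈ A, IsSelfAdjoint a → ‖(a : H →L[ℂ] H)‖ ≤ 1 → a * y = y * a := by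
    intro a ha hsa hn
    obtain ⟨u, hu, h1, h2, h3⟩ := hA.exists_unitary ha hsa hn
    have e1 := h u hu h1 h2
    have e2 := h (star u) (star_mem hu) (by rwa [star_star]) (by rwa [star_star])
    have e3 : (a + a) * y = y * (a + a) := by rw [← h3, add_mul, mul_add, e1, e2]
    rw [← two_smul ℂ a, smul_mul_assoc, mul_smul_comm] at e3
    exact (smul_right_injective _ (two_ne_zero' ℂ)) e3
  have hsa : ∀ a ∈ A, IsSelfAdjoint a → a * y = y * a := by
    intro a ha hsa
    have hpos : 0 < ‖(a : H →L[ℂ] H)‖ + 1 := by positivity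
    set r : ℝ := (‖(a : H →L[ℂ] H)‖ + 1)⁻¹ with hr
    have hr0 : 0 < r := inv_pos.2 hpos
    have e := hball ((r : ℂ) • a) (SMulMemClass.smul_mem _ ha) (by
      rw [IsSelfAdjoint, star_smul, hsa.star_eq]; simp) (by
      change ‖(r : ℂ) • (a : H →L[ℂ] H)‖ ≤ 1
      rw [norm_smul, Complex.norm_real, Real.norm_of_nonneg hr0.le, hr, inv_mul_le_one₀ hpos]
      linarith)
    rw [smul_mul_assoc, mul_smul_comm] at e
    exact (smul_right_injective _ (Complex.ofReal_ne_zero.2 hr0.ne')) e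
  intro a ha
  have e1 := hsa (a + star a) (add_mem ha (star_mem ha)) (IsSelfAdjoint.add_star_self a)
  have e2 := hsa (Complex.I • (a - star a))
    (SMulMemClass.smul_mem _ (sub_mem ha (star_mem ha))) (by
      rw [IsSelfAdjoint, star_smul, star_sub, star_star, ← neg_sub a, smul_neg]; simp)
  rw [smul_mul_assoc, mul_smul_comm] at e2
  replace e2 := smul_right_injective _ Complex.I_ne_zero e2
  rw [add_mul, mul_add] at e1
  simp only [sub_mul, mul_sub] at e2
  have e3 : (2 : ℂ) • (a * y) = (2 : ℂ) • (y * a) := by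
    rw [two_smul, two_smul]
    calc a * y + a * y = (a * y + star a * y) + (a * y - star a * y) := by abel
      _ = _ := by rw [e1, e2]; abel
  exact smul_right_injective _ (two_ne_zero' ℂ) e3

/-! ### Order and trace on `M` -/

variable {τ : Elt M →ₗ[ℂ] ℂ} {A : StarSubalgebra ℂ (Elt M)}

lemma elt_smul_nonneg {r : ℝ} (hr : 0 ≤ r) {x : Elt M} (hx : 0 ≤ x) : 0 ≤ r • x :=
  show (0 : H →L[ℂ] H) ≤ r • (x : H →L[ℂ] H) from smul_nonneg hr hx

lemma elt_star_mul_self_nonneg (x : Elt M) : 0 ≤ star x * x :=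
  star_mul_self_nonneg (x : H →L[ℂ] H)

lemma elt_conjugate_nonneg {x : Elt M} (hx : 0 ≤ x) (u : Elt M) : 0 ≤ u * x * star u :=
  star_right_conjugate_nonneg (show 0 ≤ (x : H →L[ℂ] H) from hx) (u : H →L[ℂ] H)

lemma elt_isSelfAdjoint {x : Elt M} (hx : 0 ≤ x) : IsSelfAdjoint x :=
  Subtype.ext (show 0 ≤ (x : H →L[ℂ] H) from hx).isSelfAdjoint

lemma exists_shift_nonneg {x : Elt M} (hx : IsSelfAdjoint x) :
    ∃ r : ℝ, 0 < r ∧ 0 ≤ r • 1 + x ∧ 0 ≤ r • 1 - x := by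
  have hT : IsSelfAdjoint (x : H →L[ℂ] H) := congrArg Subtype.val hx
  have h1 := hT.neg_algebraMap_norm_le_self
  have h2 := hT.le_algebraMap_norm_self
  have h3 : (0 : H →L[ℂ] H) ≤ 1 := zero_le_one
  rw [Algebra.algebraMap_eq_smul_one] at h1 h2
  refine ⟨‖(x : H →L[ℂ] H)‖ + 1, by positivity, ?_, ?_⟩
  · change (0 : H →L[ℂ] H) ≤ (‖(x : H →L[ℂ] H)‖ + 1) • (1 : H →L[ℂ] H) + x
    rw [add_smul, one_smul, add_right_comm]
    exact add_nonneg (neg_le_iff_add_nonneg'.1 h1) h3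
  · change (0 : H →L[ℂ] H) ≤ (‖(x : H →L[ℂ] H)‖ + 1) • (1 : H →L[ℂ] H) - x
    rw [add_smul, one_smul, add_sub_right_comm]
    exact add_nonneg (sub_nonneg.2 h2) h3

lemma map_real_smul (φ : Elt M →ₗ[ℂ] ℂ) (r : ℝ) (x : Elt M) : φ (r • x) = r * φ x :=
  (φ.map_smul_of_tower r x).trans (Complex.real_smul)

lemma IsFaithfulNormalTrace.im_eq_zero (hτ : IsFaithfulNormalTrace τ) {x : Elt M}
    (hx : IsSelfAdjoint x) : (τ x).im = 0 := by
  obtain ⟨r, -, h, -⟩ := exists_shift_nonneg hx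
  have := (Complex.nonneg_iff.1 (hτ.nonneg _ h)).2
  rw [map_add, map_real_smul, hτ.map_one] at this
  simpa using this.symm

lemma IsFaithfulNormalTrace.map_star (hτ : IsFaithfulNormalTrace τ) (x : Elt M) :
    τ (star x) = starRingEnd ℂ (τ x) := by
  have h1 := hτ.im_eq_zero (IsSelfAdjoint.add_star_self x)
  have h2 := hτ.im_eq_zero (x := Complex.I • (x - star x)) (by
    rw [IsSelfAdjoint, star_smul, star_sub, star_star, ← neg_sub x, smul_neg]; simp)
  simp only [map_add, map_smul, map_sub, Complex.add_im, smul_eq_mul, Complex.mul_im,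
    Complex.I_re, Complex.I_im, Complex.sub_re] at h1 h2
  apply Complex.ext
  · rw [Complex.conj_re]; linarith
  · rw [Complex.conj_im]; linarith

lemma IsFaithfulNormalTrace.eq_zero (hτ : IsFaithfulNormalTrace τ) {x : Elt M}
    (hx : τ (star x * x) = 0) : x = 0 := by
  have h := hτ.faithful _ (elt_star_mul_self_nonneg x) hx
  apply Subtype.ext
  exact CStarRing.star_mul_self_eq_zero_iff (x : H →L[ℂ] H) |>.1 (congrArg Subtype.val h)

lemma IsFaithfulNormalTrace.eq_of_forall (hτ : IsFaithfulNormalTrace τ) {y y' : Elt M}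
    (hy : y ∈ A) (hy' : y' ∈ A) (h : ∀ a ∈ A, τ (a * y) = τ (a * y')) : y = y' := by
  refine sub_eq_zero.1 (hτ.eq_zero ?_)
  rw [mul_sub, map_sub, h _ (star_mem (sub_mem hy hy')), sub_self]

/-! ### Existence of the conditional expectation -/

/-- The effects `y` of `M` with `τ (a y) = τ (a x)` for all `a` in `A`. -/
def traceFiber (τ : Elt M →ₗ[ℂ] ℂ) (A : StarSubalgebra ℂ (Elt M)) (x : Elt M) :
    Set (WeakElt M) :=
  effects M ∩ {y | ∀ a ∈ A, τ (a * (show Elt M from y)) = τ (a * x)}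

lemma IsFaithfulNormalTrace.continuousOn_mulLeft (hτ : IsFaithfulNormalTrace τ) (a : Elt M) :
    ContinuousOn (fun y : WeakElt M => τ (a * (show Elt M from y))) (effects M) :=
  (hτ.normal.comp_mulLeft a).continuousOn

lemma isCompact_traceFiber (hτ : IsFaithfulNormalTrace τ) (x : Elt M) :
    IsCompact (traceFiber τ A x) := by
  have hE := isCompact_effects (M := M)
  refine hE.of_isClosed_subset ?_ Set.inter_subset_left
  have : traceFiber τ A x = effects M ∩ ⋂ a ∈ A, effects M ∩
      (fun y : WeakElt M => τ (a * (show Elt M from y))) ⁻¹' {τ (a * x)} := by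
    ext y
    simp only [traceFiber, Set.mem_inter_iff, Set.mem_iInter, Set.mem_preimage,
      Set.mem_singleton_iff]
    exact ⟨fun h => ⟨h.1, fun a ha => ⟨h.1, h.2 a ha⟩⟩, fun h => ⟨h.1, fun a ha => (h.2 a ha).2⟩⟩
  rw [this]
  exact hE.isClosed.inter (isClosed_biInter fun a _ =>
    (hτ.continuousOn_mulLeft a).preimage_isClosed_of_isClosed hE.isClosed isClosed_singleton)

lemma IsFaithfulNormalTrace.re_mul_self_sub (hτ : IsFaithfulNormalTrace τ) (y z : Elt M) :
    (τ ((y - z) * (y - z))).re = (τ (y * y)).re - 2 * (τ (y * z)).re + (τ (z * z)).re := by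
  rw [sub_mul, mul_sub, mul_sub]
  simp only [map_sub, Complex.sub_re, hτ.trace z y]
  ring

lemma IsFaithfulNormalTrace.re_mul_self_nonneg (hτ : IsFaithfulNormalTrace τ) {y : Elt M}
    (hy : IsSelfAdjoint y) : 0 ≤ (τ (y * y)).re := by
  have := hτ.nonneg _ (elt_star_mul_self_nonneg y)
  rw [hy.star_eq] at this
  exact (Complex.nonneg_iff.1 this).1

/-- The function `y ↦ τ (y²)` attains its minimum on `traceFiber τ A x`. -/
lemma exists_isMinOn_traceFiber (hτ : IsFaithfulNormalTrace τ) {x : Elt M} (h0 : 0 ≤ x)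
    (h1 : x ≤ 1) : ∃ y : Elt M, y ∈ traceFiber τ A x ∧
      ∀ z : Elt M, z ∈ traceFiber τ A x → (τ (y * y)).re ≤ (τ (z * z)).re := by
  have hne : (traceFiber τ A x).Nonempty := ⟨x, ⟨h0, h1⟩, fun a _ => rfl⟩
  let f : WeakElt M → ℝ := fun y => (τ ((show Elt M from y) * (show Elt M from y))).re
  have hlsc : LowerSemicontinuousOn f (traceFiber τ A x) := by
    intro y hy r hr
    -- The function `g` is a weakly continuous affine minorant of `f` touching it at `y`, since
    -- `τ((y - z)²) ≥ 0`. This gives lower semicontinuity without continuity of `f`.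
    let g : WeakElt M → ℝ := fun z => 2 * (τ ((show Elt M from y) * (show Elt M from z))).re - f y
    have hg : ContinuousOn g (traceFiber τ A x) :=
      ((continuousOn_const.mul (Complex.continuous_re.comp_continuousOn
        (hτ.continuousOn_mulLeft _))).sub continuousOn_const).mono Set.inter_subset_left
    have hgy : r < g y := by
      have : g y = f y := by simp only [g, f]; ring
      rwa [this]
    filter_upwards [(hg y hy).eventually_const_lt hgy, self_mem_nhdsWithin] with z hz hzK
    refine hz.trans_le ?_
    have h2 := hτ.re_mul_self_nonneg
      ((elt_isSelfAdjoint hy.1.1).sub (elt_isSelfAdjoint hzK.1.1))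
    rw [hτ.re_mul_self_sub] at h2
    simp only [g, f]
    linarith
  obtain ⟨y, hy, hmin⟩ := hlsc.exists_isMinOn hne (isCompact_traceFiber hτ x)
  exact ⟨y, hy, fun z hz => hmin hz⟩

lemma conjugate_mem_traceFiber (hτ : IsFaithfulNormalTrace τ) (hA : IsMasa A) {x y u : Elt M}
    (hy : y ∈ traceFiber τ A x) (hu : u ∈ A) (h1 : star u * u = 1) (h2 : u * star u = 1) :
    (u * y * star u : Elt M) ∈ traceFiber τ A x := by
  refine ⟨⟨elt_conjugate_nonneg hy.1.1 u, sub_nonneg.1 ?_⟩, fun a ha => ?_⟩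
  · have := elt_conjugate_nonneg (sub_nonneg.2 hy.1.2) u
    rwa [mul_sub, sub_mul, mul_one, h2] at this
  · refine Eq.trans ?_ (hy.2 a ha)
    change τ (a * (u * y * star u)) = τ (a * y)
    rw [← mul_assoc, hτ.trace, ← mul_assoc, ← mul_assoc, mul_assoc (star u), hA.prop a ha u hu,
      ← mul_assoc, h1, one_mul]

lemma midpoint_mem_traceFiber {x y z : Elt M} (hy : y ∈ traceFiber τ A x)
    (hz : z ∈ traceFiber τ A x) :
    ((2⁻¹ : ℝ) • (y + z) : Elt M) ∈ traceFiber τ A x := by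
  refine ⟨⟨elt_smul_nonneg (by norm_num) (add_nonneg hy.1.1 hz.1.1), sub_nonneg.1 ?_⟩,
    fun a ha => ?_⟩
  · have := elt_smul_nonneg (r := 2⁻¹) (by norm_num)
      (add_nonneg (sub_nonneg.2 hy.1.2) (sub_nonneg.2 hz.1.2))
    refine this.trans_eq ?_
    change (2⁻¹ : ℝ) • ((1 - y) + (1 - z)) = 1 - (2⁻¹ : ℝ) • (y + z)
    module
  · have e1 : τ (a * y) = τ (a * x) := hy.2 a ha
    have e2 : τ (a * z) = τ (a * x) := hz.2 a ha
    change τ (a * ((2⁻¹ : ℝ) • (y + z))) = τ (a * x)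
    rw [mul_smul_comm, map_real_smul, mul_add, map_add, e1, e2]
    push_cast
    ring

/-- Conjugating the minimizer of `τ(y²)` by a unitary of `A` gives another minimizer. By strict
convexity the two agree, so the minimizer commutes with `A` and lies in it. -/
lemma exists_mem_masa_of_effect (hτ : IsFaithfulNormalTrace τ) (hA : IsMasa A) {x : Elt M}
    (h0 : 0 ≤ x) (h1 : x ≤ 1) :
    ∃ y ∈ A, 0 ≤ y ∧ ∀ a ∈ A, τ (a * y) = τ (a * x) := by
  obtain ⟨y, hy, hmin⟩ := exists_isMinOn_traceFiber (A := A) hτ h0 h1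
  have hysa : IsSelfAdjoint y := elt_isSelfAdjoint hy.1.1
  refine ⟨y, hA.mem_of_commute hysa (hA.commute_of_commute_unitary fun u hu hu1 hu2 => ?_),
    hy.1.1, hy.2⟩
  have hz := conjugate_mem_traceFiber hτ hA hy hu hu1 hu2
  set z : Elt M := u * y * star u with hzdef
  have hzsa : IsSelfAdjoint z := elt_isSelfAdjoint hz.1.1
  have hzz : τ (z * z) = τ (y * y) := by
    have : z * z = u * (y * y) * star u := by
      rw [hzdef]
      calc u * y * star u * (u * y * star u) = u * y * (star u * u) * y * star u := by
            simp only [mul_assoc]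
        _ = _ := by rw [hu1, mul_one]; simp only [mul_assoc]
    rw [this, hτ.trace, ← mul_assoc, hu1, one_mul]
  have hm := hmin _ (midpoint_mem_traceFiber hy hz)
  rw [smul_mul_smul_comm, map_real_smul, Complex.re_ofReal_mul, add_mul, mul_add, mul_add] at hm
  simp only [map_add, Complex.add_re, hzz, hτ.trace z y] at hm
  have hsub := hτ.re_mul_self_sub y z
  rw [hzz] at hsub
  have hnn := hτ.re_mul_self_nonneg (hysa.sub hzsa)
  have hre : (τ ((y - z) * (y - z))).re = 0 := by linarith
  have hyz : y - z = 0 := by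
    apply hτ.eq_zero
    rw [(hysa.sub hzsa).star_eq]
    refine Complex.ext hre (hτ.im_eq_zero ?_)
    have := IsSelfAdjoint.star_mul_self (y - z)
    rwa [(hysa.sub hzsa).star_eq] at this
  have hyz' : y = u * y * star u := sub_eq_zero.1 hyz
  calc u * y = u * y * (star u * u) := by rw [hu1, mul_one]
    _ = (u * y * star u) * u := by simp only [mul_assoc]
    _ = y * u := by rw [← hyz']

lemma exists_mem_masa_of_nonneg (hτ : IsFaithfulNormalTrace τ) (hA : IsMasa A) {x : Elt M}
    (h0 : 0 ≤ x) :
    ∃ y ∈ A, 0 ≤ y ∧ ∀ a ∈ A, τ (a * y) = τ (a * x) := by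
  obtain ⟨r, hr, -, h⟩ := exists_shift_nonneg (elt_isSelfAdjoint h0)
  obtain ⟨y, hyA, hy0, hy⟩ := exists_mem_masa_of_effect hτ hA
    (elt_smul_nonneg (inv_nonneg.2 hr.le) h0) (sub_nonneg.1 (by
      have := elt_smul_nonneg (inv_nonneg.2 hr.le) h
      rwa [smul_sub, smul_smul, inv_mul_cancel₀ hr.ne', one_smul] at this))
  refine ⟨r • y, SMulMemClass.smul_mem (r : ℂ) hyA, elt_smul_nonneg hr.le hy0, fun a ha => ?_⟩
  rw [mul_smul_comm, map_real_smul, hy a ha, mul_smul_comm, map_real_smul, ← mul_assoc,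
    ← Complex.ofReal_mul, mul_inv_cancel₀ hr.ne', Complex.ofReal_one, one_mul]

lemma exists_mem_masa_of_isSelfAdjoint (hτ : IsFaithfulNormalTrace τ) (hA : IsMasa A)
    {x : Elt M} (hx : IsSelfAdjoint x) : ∃ y ∈ A, ∀ a ∈ A, τ (a * y) = τ (a * x) := by
  obtain ⟨r, hr, h, -⟩ := exists_shift_nonneg hx
  obtain ⟨y, hyA, -, hy⟩ := exists_mem_masa_of_nonneg hτ hA h
  refine ⟨y - r • 1, sub_mem hyA (SMulMemClass.smul_mem (r : ℂ) (one_mem A)), fun a ha => ?_⟩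
  rw [mul_sub, map_sub, hy a ha, ← map_sub, ← mul_sub, add_sub_cancel_left]

lemma exists_mem_masa (hτ : IsFaithfulNormalTrace τ) (hA : IsMasa A) (x : Elt M) :
    ∃ y : A, ∀ a ∈ A, τ (a * y) = τ (a * x) := by
  obtain ⟨y, hyA, hy⟩ := exists_mem_masa_of_isSelfAdjoint hτ hA (realPart x).2
  obtain ⟨z, hzA, hz⟩ := exists_mem_masa_of_isSelfAdjoint hτ hA (imaginaryPart x).2
  refine ⟨⟨y + Complex.I • z, add_mem hyA (SMulMemClass.smul_mem _ hzA)⟩, fun a ha => ?_⟩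
  conv_rhs => rw [← realPart_add_I_smul_imaginaryPart x]
  simp only [mul_add, map_add, mul_smul_comm, map_smul, hy a ha, hz a ha]

/-- Faithfulness makes the representing element of `A` unique, and uniqueness gives linearity and
the bimodule property. -/
lemma exists_isTraceCondExp (hτ : IsFaithfulNormalTrace τ) (hA : IsMasa A) :
    ∃ E : Elt M →ₗ[ℂ] A, IsTraceCondExp τ A E := by
  choose F hF using exists_mem_masa hτ hA
  have huniq : ∀ {x : Elt M} {y : A}, (∀ a ∈ A, τ (a * y) = τ (a * x)) → F x = y :=
    fun {x y} h => Subtype.ext (hτ.eq_of_forall (F x).2 y.2 fun a ha => by rw [hF x a ha, h a ha])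
  refine ⟨{ toFun := F, map_add' := fun x y => huniq fun a ha => ?_,
            map_smul' := fun c x => huniq fun a ha => ?_ },
    ⟨fun x hx => ?_, fun a => huniq fun b _ => rfl, fun a b x => huniq fun c hc => ?_,
      fun x => ?_⟩⟩
  · change τ (a * ((F x : Elt M) + F y)) = τ (a * (x + y))
    rw [mul_add, map_add, hF x a ha, hF y a ha, mul_add, map_add]
  · change τ (a * (c • (F x : Elt M))) = τ (a * (c • x))
    rw [mul_smul_comm, map_smul, hF x a ha, mul_smul_comm, map_smul]
  · obtain ⟨y, hyA, hy0, hy⟩ := exists_mem_masa_of_nonneg hτ hA hx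
    have : F x = ⟨y, hyA⟩ := huniq hy
    change 0 ≤ F x
    rw [this]
    exact hy0
  · change τ (c * ((a : Elt M) * (F x : Elt M) * b)) = τ (c * (a * x * b))
    have key : ∀ w : Elt M, τ (c * (a * w * b)) = τ ((b : Elt M) * c * a * w) := fun w => by
      rw [← mul_assoc, hτ.trace]
      simp only [mul_assoc]
    rw [key, key, hF x _ (mul_mem (mul_mem b.2 hc) a.2)]
  · have := hF x 1 (one_mem A)
    rwa [one_mul, one_mul] at this

lemma isTraceCondExp_condExp (hτ : IsFaithfulNormalTrace τ) (hA : IsMasa A) :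
    IsTraceCondExp τ A (condExp τ A) :=
  Classical.epsilon_spec (exists_isTraceCondExp hτ hA)

lemma trace_mul_condExp (hτ : IsFaithfulNormalTrace τ) (hA : IsMasa A) {a : Elt M} (ha : a ∈ A)
    (y : Elt M) : τ (a * condExp τ A y) = τ (a * y) := by
  have hE := isTraceCondExp_condExp hτ hA
  have h := hE.bimodule ⟨a, ha⟩ 1 y
  rw [OneMemClass.coe_one, mul_one, mul_one] at h
  rw [← hE.trace (a * y)]
  exact congrArg (fun w : A => τ w) h.symm

lemma condExp_eq_iff (hτ : IsFaithfulNormalTrace τ) (hA : IsMasa A) (y : Elt M) (x : A) :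
    condExp τ A y = x ↔ ∀ a ∈ A, τ (a * y) = τ (a * x) := by
  constructor
  · rintro rfl a ha
    exact (trace_mul_condExp hτ hA ha y).symm
  · intro h
    exact Subtype.ext (hτ.eq_of_forall (condExp τ A y).2 x.2 fun a ha => by
      rw [trace_mul_condExp hτ hA ha, h a ha])

lemma fiber_eq_traceFiber (hτ : IsFaithfulNormalTrace τ) (hA : IsMasa A) (x : A) :
    fiber τ A x = traceFiber τ A (x : Elt M) := by
  ext y
  change (0 ≤ y ∧ y ≤ 1 ∧ condExp τ A y = x) ↔ (0 ≤ y ∧ y ≤ 1) ∧ _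
  rw [condExp_eq_iff hτ hA, and_assoc]
  rfl

/-! ### Range projections and cutting down a non-projection -/

/-- The projection onto the closure of the range of `b`. -/
def rangeProj (b : H →L[ℂ] H) : H →L[ℂ] H :=
  haveI : CompleteSpace b.range.topologicalClosure :=
    b.range.isClosed_topologicalClosure.completeSpace_coe
  b.range.topologicalClosure.starProjection

lemma isStarProjection_rangeProj (b : H →L[ℂ] H) : IsStarProjection (rangeProj b) :=
  haveI : CompleteSpace b.range.topologicalClosure :=
    b.range.isClosed_topologicalClosure.completeSpace_coe
  isStarProjection_starProjection

lemma rangeProj_apply_mem (b : H →L[ℂ] H) (ξ : H) : rangeProj b ξ ∈ closure (Set.range b) :=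
  haveI : CompleteSpace b.range.topologicalClosure :=
    b.range.isClosed_topologicalClosure.completeSpace_coe
  b.range.topologicalClosure.starProjection_apply_mem ξ

lemma rangeProj_eq_self (b : H →L[ℂ] H) {ξ : H} (h : ξ ∈ closure (Set.range b)) :
    rangeProj b ξ = ξ :=
  haveI : CompleteSpace b.range.topologicalClosure :=
    b.range.isClosed_topologicalClosure.completeSpace_coe
  Submodule.starProjection_eq_self_iff.2 h

lemma rangeProj_mul_self (b : H →L[ℂ] H) : rangeProj b * b = b := by
  ext ξ
  exact rangeProj_eq_self b (subset_closure ⟨ξ, rfl⟩)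

lemma rangeProj_mul_mul_rangeProj {b S : H →L[ℂ] H} (h : Commute S b) :
    rangeProj b * S * rangeProj b = S * rangeProj b := by
  ext ξ
  refine rangeProj_eq_self b (map_mem_closure S.continuous (rangeProj_apply_mem b ξ) ?_)
  rintro _ ⟨η, rfl⟩
  exact ⟨S η, (congrArg (fun T : H →L[ℂ] H => T η) h.eq).symm⟩

/-- The closed range of `b` is invariant under `S` and `S*`, hence reduces `S`. -/
lemma commute_rangeProj {b S : H →L[ℂ] H} (h : Commute S b) (h' : Commute (star S) b) :
    Commute S (rangeProj b) := by
  have e1 := rangeProj_mul_mul_rangeProj h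
  have e2 := congrArg star (rangeProj_mul_mul_rangeProj h')
  simp only [star_mul, star_star, (isStarProjection_rangeProj b).isSelfAdjoint.star_eq] at e2
  rw [← mul_assoc] at e2
  exact (e1.symm.trans e2)

/-- An operator with nonnegative quadratic form on the range of `b` has one on its closure. -/
lemma rangeProj_conjugate_nonneg {b d : H →L[ℂ] H} (h : 0 ≤ star b * d * b) :
    0 ≤ rangeProj b * d * rangeProj b := by
  rw [opNonneg_iff] at h ⊢
  intro ξ
  have hsub : closure (Set.range b) ⊆ {v | 0 ≤ ⟪v, d v⟫_ℂ} := by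
    refine closure_minimal ?_ (isClosed_le continuous_const
      (continuous_id.inner d.continuous))
    rintro _ ⟨η, rfl⟩
    have := h η
    rw [mul_apply_eq_comp, mul_apply_eq_comp, ContinuousLinearMap.star_eq_adjoint,
      ContinuousLinearMap.adjoint_inner_right] at this
    exact this
  have := hsub (rangeProj_apply_mem b ξ)
  have hsa := (isStarProjection_rangeProj b).isSelfAdjoint
  rw [mul_apply_eq_comp, mul_apply_eq_comp, ← ContinuousLinearMap.adjoint_inner_left,
    ← ContinuousLinearMap.star_eq_adjoint, hsa.star_eq]
  exact this

lemma posPart_mul_mul_posPart_nonneg {d : H →L[ℂ] H} (hd : IsSelfAdjoint d) :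
    0 ≤ star d⁺ * d * d⁺ := by
  have hb : 0 ≤ d⁺ := CFC.posPart_nonneg d
  have h1 : d⁺ * d = d⁺ * d⁺ := by
    conv_lhs => enter [2]; rw [← CFC.posPart_sub_negPart d hd]
    rw [mul_sub, CFC.posPart_mul_negPart, sub_zero]
  have h2 := star_left_conjugate_nonneg hb d⁺
  rw [hb.isSelfAdjoint.star_eq] at h2 ⊢
  rwa [h1]

/-- If `0 ≤ y ≤ 1` in `M` is not a projection, then `ε ≤ y ≤ 1 - ε` on a nonzero reducing
projection `e` of `M`. -/
lemma exists_projection_of_not_isStarProjection {y : Elt M} (h0 : 0 ≤ y) (h1 : y ≤ 1)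
    (hy : ¬ IsStarProjection y) :
    ∃ e : Elt M, IsStarProjection e ∧ e ≠ 0 ∧ ∃ ε : ℝ, 0 < ε ∧ 0 ≤ y - ε • e ∧
      0 ≤ (1 - y) - ε • e := by
  set T : H →L[ℂ] H := y.1 with hT
  have hT0 : 0 ≤ T := h0
  have hT1 : 0 ≤ 1 - T := sub_nonneg.2 (show T ≤ 1 from h1)
  have hTsa : IsSelfAdjoint T := hT0.isSelfAdjoint
  -- `c = T(1 - T)` vanishes only if `T` is a projection; it equals `T(1 - T)T + (1 - T)T(1 - T) ≥
  -- 0`.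
  set c : H →L[ℂ] H := T - T * T with hc
  have hc0 : 0 ≤ c := by
    have e1 := star_left_conjugate_nonneg hT1 T
    have e2 := star_left_conjugate_nonneg hT0 (1 - T)
    rw [hTsa.star_eq] at e1
    rw [hT1.isSelfAdjoint.star_eq] at e2
    refine (add_nonneg e1 e2).trans_eq ?_
    rw [hc]
    noncomm_ring
  have hcne : c ≠ 0 := by
    intro h
    exact hy ⟨Subtype.ext (sub_eq_zero.1 h).symm, Subtype.ext hTsa⟩
  have hcpos : 0 < ‖c‖ := norm_pos_iff.2 hcne
  -- Any `0 < ε < ‖c‖` leaves `c - ε` a nonzero positive part. Its range projection `e` plays the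
  -- role of the spectral projection of `c` for `(ε, ∞)`.
  set ε : ℝ := ‖c‖ / 2 with hε
  have hεpos : 0 < ε := half_pos hcpos
  set d : H →L[ℂ] H := c - algebraMap ℝ (H →L[ℂ] H) ε with hd
  have hdsa : IsSelfAdjoint d := hc0.isSelfAdjoint.sub (IsSelfAdjoint.algebraMap _ (.all ε))
  have hbne : d⁺ ≠ 0 := by
    intro h
    rw [CFC.posPart_eq_zero_iff d hdsa, sub_nonpos,
      ← CStarAlgebra.norm_le_iff_le_algebraMap c hεpos.le hc0] at h
    linarith
  set e : H →L[ℂ] H := rangeProj d⁺ with he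
  have hep : IsStarProjection e := isStarProjection_rangeProj _
  have hcommb : ∀ S : H →L[ℂ] H, Commute S T → Commute S d⁺ := by
    intro S hS
    have hSd : Commute S d :=
      (hS.sub_right (hS.mul_right hS)).sub_right (Algebra.commutes' ε S).symm
    rw [CFC.posPart_def]
    exact (hSd.symm.cfcₙ_real _).symm
  have hcomm : ∀ S : H →L[ℂ] H, Commute S T → Commute (star S) T → Commute S e :=
    fun S hS hS' => commute_rangeProj (hcommb S hS) (hcommb _ hS')
  have heM : e ∈ M := mem_vonNeumannAlgebra_of_commute fun S hS =>
    hcomm S (VonNeumannAlgebra.mem_commutant_iff.1 hS _ y.2).symm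
      (VonNeumannAlgebra.mem_commutant_iff.1 (star_mem hS) _ y.2).symm
  have hTe : Commute T e := hcomm T rfl (by rw [hTsa.star_eq])
  have hene : e ≠ 0 := by
    intro h
    have := rangeProj_mul_self d⁺
    rw [← he, h, zero_mul] at this
    exact hbne this.symm
  have hede : 0 ≤ e * d * e := rangeProj_conjugate_nonneg (posPart_mul_mul_posPart_nonneg hdsa)
  have hee : e * e = e := hep.isIdempotentElem
  have hdd : e * d * e = e * c * e - ε • e := by
    rw [hd, mul_sub, sub_mul, Algebra.algebraMap_eq_smul_one, mul_smul_comm, mul_one,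
      smul_mul_assoc, hee]
  -- `S ≥ 0` off `e`, and `eSe ≥ ece ≥ εe`. It applies to `T` and `1 - T`, as `T - c = T²` and `(1 -
  -- T) - c = (1 - T)²`.
  have main : ∀ S : H →L[ℂ] H, 0 ≤ S → Commute S e → 0 ≤ S - c → 0 ≤ S - ε • e := by
    intro S hS hSe hSc
    have e1 := star_left_conjugate_nonneg hS (1 - e)
    have e2 := star_left_conjugate_nonneg hSc e
    rw [hep.one_sub.isSelfAdjoint.star_eq] at e1
    rw [hep.isSelfAdjoint.star_eq, mul_sub, sub_mul] at e2
    have e3 : (1 - e) * S * (1 - e) = S - e * S * e := by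
      have h4 : e * S = e * S * e := by rw [← hSe.eq, mul_assoc, hee]
      calc (1 - e) * S * (1 - e) = S - S * e - e * S + e * S * e := by noncomm_ring
        _ = S - e * S * e := by rw [hSe.eq, ← h4]; abel
    rw [hdd] at hede
    refine (add_nonneg (add_nonneg e1 e2) hede).trans_eq ?_
    rw [e3]
    abel
  refine ⟨⟨e, heM⟩, ⟨Subtype.ext hee, Subtype.ext hep.isSelfAdjoint⟩,
    fun h => hene (congrArg Subtype.val h), ε, hεpos, main T hT0 hTe ?_,
    main (1 - T) hT1 ((Commute.one_left e).sub_left hTe) ?_⟩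
  · have := star_mul_self_nonneg T
    rw [hTsa.star_eq] at this
    rwa [hc, sub_sub_cancel]
  · have := star_mul_self_nonneg (1 - T)
    rw [hT1.isSelfAdjoint.star_eq] at this
    refine this.trans_eq ?_
    rw [hc]
    noncomm_ring

/-! ### Perturbation inside the fiber and extreme points -/

lemma mem_corner_iff {e : Elt M} (he : IsStarProjection e) {z : Elt M} :
    z ∈ corner e ↔ e * z * e = z := by
  have hee : e * e = e := he.isIdempotentElem
  constructor
  · rintro ⟨w, rfl⟩
    change e * (e * (w * e)) * e = e * (w * e)
    rw [← mul_assoc e e, hee, mul_assoc, mul_assoc w, hee]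
  · intro h
    exact ⟨z, (mul_assoc e z e).symm.trans h⟩

/-- If `Φ_e` is not injective, its kernel contains a nonzero self-adjoint element. -/
lemma exists_isSelfAdjoint_mem_ker (hτ : IsFaithfulNormalTrace τ) (hA : IsMasa A) {e : Elt M}
    (he : IsStarProjection e) (hΦ : ¬ Function.Injective (cornerMap τ A e)) :
    ∃ z : Elt M, IsSelfAdjoint z ∧ z ≠ 0 ∧ e * z * e = z ∧ ∀ a ∈ A, τ (a * z) = 0 := by
  rw [injective_iff_map_eq_zero] at hΦ
  push Not at hΦ
  obtain ⟨⟨z, hz⟩, hEz, hzne⟩ := hΦ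
  rw [mem_corner_iff he] at hz
  have hzne' : z ≠ 0 := fun h => hzne (Subtype.ext h)
  have hzτ : ∀ a ∈ A, τ (a * z) = 0 := fun a ha => by
    have := (condExp_eq_iff hτ hA z 0).1 hEz a ha
    rwa [ZeroMemClass.coe_zero, mul_zero, map_zero] at this
  have hzs : ∀ a ∈ A, τ (a * star z) = 0 := fun a ha => by
    have := hτ.map_star (star a * z)
    rw [hzτ _ (star_mem ha), map_zero, star_mul, star_star] at this
    rw [hτ.trace, this]
  have hzse : e * star z * e = star z := by
    have := congrArg star hz
    rwa [star_mul, star_mul, he.isSelfAdjoint.star_eq, ← mul_assoc] at this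
  -- The kernel is closed under adjoints. If `z + z*` vanishes, `z` is skew-adjoint and `iz` serves
  -- instead.
  by_cases h : z + star z = 0
  · refine ⟨Complex.I • z, ?_, smul_ne_zero Complex.I_ne_zero hzne', ?_, fun a ha => ?_⟩
    · rw [IsSelfAdjoint, star_smul, eq_neg_of_add_eq_zero_right h]
      simp
    · rw [mul_smul_comm, smul_mul_assoc, hz]
    · rw [mul_smul_comm, map_smul, hzτ a ha, smul_zero]
  · refine ⟨z + star z, IsSelfAdjoint.add_star_self z, h, ?_, fun a ha => ?_⟩
    · rw [mul_add, add_mul, hz, hzse]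
    · rw [mul_add, map_add, hzτ a ha, hzs a ha, add_zero]

/-- Compressing `r ± z ≥ 0` by `e` gives `re ± z ≥ 0`; then scale by `δ = ε/r`. -/
lemma exists_smul_between {e z : Elt M} (he : IsStarProjection e) (hz : IsSelfAdjoint z)
    (hez : e * z * e = z) {ε : ℝ} (hε : 0 < ε) :
    ∃ δ : ℝ, 0 < δ ∧ 0 ≤ ε • e + δ • z ∧ 0 ≤ ε • e - δ • z := by
  obtain ⟨r, hr, h1, h2⟩ := exists_shift_nonneg hz
  have hee : e * e = e := he.isIdempotentElem
  have hδ : 0 < ε / r := div_pos hε hr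
  replace h1 := elt_smul_nonneg hδ.le (elt_conjugate_nonneg h1 e)
  replace h2 := elt_smul_nonneg hδ.le (elt_conjugate_nonneg h2 e)
  rw [he.isSelfAdjoint.star_eq, mul_add, add_mul, mul_smul_comm, smul_mul_assoc, mul_one, hee,
    hez, smul_add, smul_smul, div_mul_cancel₀ _ hr.ne'] at h1
  rw [he.isSelfAdjoint.star_eq, mul_sub, sub_mul, mul_smul_comm, smul_mul_assoc, mul_one, hee,
    hez, smul_sub, smul_smul, div_mul_cancel₀ _ hr.ne'] at h2
  exact ⟨ε / r, hδ, h1, h2⟩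

lemma isStarProjection_of_mem_extremePoints (hτ : IsFaithfulNormalTrace τ) (hA : IsMasa A)
    (hΦ : ∀ e : Elt M, IsStarProjection e → e ≠ 0 → ¬ Function.Injective (cornerMap τ A e))
    {x : A} {y : Elt M} (hy : y ∈ Set.extremePoints ℝ (fiber τ A x)) : IsStarProjection y := by
  by_contra hproj
  obtain ⟨⟨hy0, hy1, hyx⟩, hext⟩ := mem_extremePoints.1 hy
  obtain ⟨e, he, hene, ε, hε, he0, he1⟩ :=
    exists_projection_of_not_isStarProjection hy0 hy1 hproj
  obtain ⟨z, hzsa, hzne, hez, hzτ⟩ := exists_isSelfAdjoint_mem_ker hτ hA he (hΦ e he hene)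
  obtain ⟨δ, hδ, hp, hm⟩ := exists_smul_between he hzsa hez hε
  rw [condExp_eq_iff hτ hA] at hyx
  have hmem : ∀ w : Elt M, 0 ≤ ε • e + w → 0 ≤ ε • e - w → (∀ a ∈ A, τ (a * w) = 0) →
      y + w ∈ fiber τ A x := by
    intro w h1 h2 h3
    refine ⟨(add_nonneg he0 h1).trans_eq (by abel),
      sub_nonneg.1 ((add_nonneg he1 h2).trans_eq (by abel)),
      (condExp_eq_iff hτ hA _ _).2 fun a ha => ?_⟩
    rw [mul_add, map_add, h3 a ha, add_zero, hyx a ha]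
  have hδτ : ∀ a ∈ A, τ (a * (δ • z)) = 0 := fun a ha => by
    rw [mul_smul_comm, map_real_smul, hzτ a ha, mul_zero]
  have h1 := hmem (δ • z) hp hm hδτ
  have h2 := hmem (-(δ • z)) (by rwa [← sub_eq_add_neg]) (by rwa [sub_neg_eq_add]) fun a ha => by
    rw [mul_neg, map_neg, hδτ a ha, neg_zero]
  -- `y` is the midpoint of `y + δz` and `y - δz`, so extremality would force `δz = 0`.
  have h3 := (hext _ h1 _ h2 ⟨2⁻¹, 2⁻¹, by norm_num, by norm_num, by norm_num, by module⟩).1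
  exact smul_ne_zero hδ.ne' hzne (add_eq_left.1 h3)

lemma extremePoints_fiber_nonempty (hτ : IsFaithfulNormalTrace τ) (hA : IsMasa A) {x : A}
    (hx0 : 0 ≤ x) (hx1 : x ≤ 1) : (Set.extremePoints ℝ (fiber τ A x)).Nonempty := by
  have hne : (traceFiber τ A (x : Elt M)).Nonempty :=
    ⟨(x : Elt M), ⟨hx0, hx1⟩, fun a _ => rfl⟩
  obtain ⟨y, hy⟩ := (isCompact_traceFiber hτ (x : Elt M)).extremePoints_nonempty hne
  rw [fiber_eq_traceFiber hτ hA]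
  exact ⟨y, hy⟩

end Carpenter

end

theorem lemma2p1 {H : Type*} [NormedAddCommGroup H] [InnerProductSpace ℂ H] [CompleteSpace H]
    (M : VonNeumannAlgebra H) (τ : Carpenter.Elt M →ₗ[ℂ] ℂ)
    (hτ : Carpenter.IsFaithfulNormalTrace τ)
    (A : StarSubalgebra ℂ (Carpenter.Elt M)) (hA : Carpenter.IsMasa A)
    (hΦ : ∀ e : Carpenter.Elt M, IsStarProjection e → e ≠ 0 →
      ¬ Function.Injective (Carpenter.cornerMap τ A e))
    (x : A) (hx0 : 0 ≤ x) (hx1 : x ≤ 1) :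
    (∃ p : Carpenter.Elt M, IsStarProjection p ∧ Carpenter.condExp τ A p = x) ∧
      ∀ y ∈ Set.extremePoints ℝ (Carpenter.fiber τ A x), IsStarProjection y := by
  have hext : ∀ y ∈ Set.extremePoints ℝ (Carpenter.fiber τ A x), IsStarProjection y :=
    fun y hy => Carpenter.isStarProjection_of_mem_extremePoints hτ hA hΦ hy
  obtain ⟨p, hp⟩ := Carpenter.extremePoints_fiber_nonempty hτ hA hx0 hx1
  exact ⟨⟨p, hext p hp, hp.1.2.2⟩, hext⟩
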